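/- Let $G$ be a finite non-abelian group and let $p$ be a prime number. Let $T$ be a transversal of the center $Z(G)$ in $G$, and let $\mathcal{T}(G)$ be the graph whose vertices are the non-central elements of $T$, two distinct vertices being adjacent if and only if they commute (up to isomorphism this graph does not depend on the choice of $T$). Then $\mathcal{T}(G)$ is isomorphic to $(p+1)K_{p-1}$, the disjoint union of $p+1$ copies of the complete graph on $p-1$ vertices, if and only if $G$ is isoclinic to some extraspecial $p$-group of order $p^3$. Here $G'$ denotes the derived subgroup of $G$ and $[x,y]=xyx^{-1}y^{-1}$. Groups $G$ and $H$ are isoclinic if there are isomorphisms $\varphi\colon G/Z(G)\to H/Z(H)$ and $\psi\colon G'\to H'$ such that $\psi(\alpha_G(xZ(G),yZ(G)))=\alpha_H(\varphi(xZ(G)),\varphi(yZ(G)))$ for all $x,y\in G$, where $\alpha_G\colon G/Z(G)\times G/Z(G)\to G'$ is the well-defined map $(xZ(G),yZ(G))\mapsto[x,y]$, and $\alpha_H$ is defined likewise. A finite non-abelian $p$-group $E$ is extraspecial if $E'=Z(E)=\Phi(E)$ and $|Z(E)|=p$, where $\Phi(E)$ is the Frattini subgroup of $E$. -/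

import Mathlib

universe u

/-- The commuting graph of a group `G` on a set `X` of elements of `G`: the vertices are the elements
of `X`, and two distinct vertices are adjacent exactly when they commute. -/
def commutingGraph {G : Type*} [Group G] (X : Set G) : SimpleGraph X where
  Adj x y := x ≠ y ∧ (x : G) * y = y * x
  symm := ⟨fun _ _ h => ⟨h.1.symm, h.2.symm⟩⟩
  loopless := ⟨fun _ h => h.1 rfl⟩

/-- The graph `𝒯(G)` computed with the transversal `T` of the center of `G`: the commuting graph of `G`
on the set of non-central elements of `T`. -/
def transversalGraph {G : Type*} [Group G] (T : Set G) :
    SimpleGraph (T \ (Subgroup.center G : Set G) : Set G) :=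
  commutingGraph (T \ (Subgroup.center G : Set G))

/-- The disjoint union of `r` copies of the graph `H`. -/
def disjointCopies (r : ℕ) {V : Type*} (H : SimpleGraph V) : SimpleGraph (Fin r × V) where
  Adj a b := a.1 = b.1 ∧ H.Adj a.2 b.2
  symm := ⟨fun _ _ h => ⟨h.1.symm, h.2.symm⟩⟩
  loopless := ⟨fun _ h => H.loopless.irrefl _ h.2⟩

/-- The commutator map `G/Z(G) × G/Z(G) → G'` sending `(xZ(G), yZ(G))` to
the commutator `x * y * x⁻¹ * y⁻¹`. -/
def commutatorMap (G : Type*) [Group G] (a b : G ⧸ Subgroup.center G) : commutator G :=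
  Quotient.liftOn₂' a b
    (fun x y => ⟨x * y * x⁻¹ * y⁻¹,
      Subgroup.commutator_mem_commutator (Subgroup.mem_top x) (Subgroup.mem_top y)⟩)
    (by
      intro x₁ y₁ x₂ y₂ hx hy
      rw [QuotientGroup.leftRel_apply, Subgroup.mem_center_iff] at hx hy
      apply Subtype.ext
      obtain ⟨z, hz, rfl⟩ : ∃ z, (∀ g, g * z = z * g) ∧ x₂ = x₁ * z :=
        ⟨x₁⁻¹ * x₂, hx, by group⟩
      obtain ⟨w, hw, rfl⟩ : ∃ w, (∀ g, g * w = w * g) ∧ y₂ = y₁ * w :=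
        ⟨y₁⁻¹ * y₂, hy, by group⟩
      change x₁ * y₁ * x₁⁻¹ * y₁⁻¹ = (x₁ * z) * (y₁ * w) * (x₁ * z)⁻¹ * (y₁ * w)⁻¹
      have e : (x₁ * z) * (y₁ * w) = x₁ * y₁ * (w * z) := by
        rw [mul_assoc, ← mul_assoc z, ← hz y₁]
        simp only [mul_assoc]
        rw [hw z]
      have e' : (y₁ * w) * (x₁ * z) = y₁ * x₁ * (w * z) := by
        rw [mul_assoc, ← mul_assoc w, ← hw x₁]
        simp only [mul_assoc]
      rw [mul_assoc _ (x₁ * z)⁻¹, ← mul_inv_rev, e, e', mul_assoc _ x₁⁻¹, ← mul_inv_rev]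
      group)

theorem commutatorMap_mk {G : Type*} [Group G] (x y : G) :
    (commutatorMap G (x : G ⧸ Subgroup.center G) (y : G ⧸ Subgroup.center G) : G) =
      x * y * x⁻¹ * y⁻¹ :=
  rfl

/-- An isoclinism from `G` to `H`: a pair of isomorphisms `φ : G/Z(G) → H/Z(H)` and `ψ : G' → H'`
compatible with the commutator maps. -/
structure Isoclinism (G H : Type*) [Group G] [Group H] where
  φ : G ⧸ Subgroup.center G ≃* H ⧸ Subgroup.center H
  ψ : commutator G ≃* commutator H
  compat : ∀ x y : G,
    ψ (commutatorMap G (x : G ⧸ Subgroup.center G) (y : G ⧸ Subgroup.center G)) =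
      commutatorMap H (φ (x : G ⧸ Subgroup.center G)) (φ (y : G ⧸ Subgroup.center G))

/-- Two groups are isoclinic if there is an isoclinism from one to the other. -/
def Isoclinic (G H : Type*) [Group G] [Group H] : Prop :=
  Nonempty (Isoclinism G H)

/-- `E` is an extraspecial `p`-group: a finite non-abelian `p`-group whose derived subgroup, center and
Frattini subgroup coincide, the center being of order `p`. -/
structure IsExtraspecial (p : ℕ) (E : Type*) [Group E] : Prop where
  finite : Finite E
  isPGroup : IsPGroup p E
  nonabelian : ¬ ∀ x y : E, x * y = y * x
  commutator_eq_center : commutator E = Subgroup.center E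
  center_eq_frattini : Subgroup.center E = frattini E
  card_center : Nat.card (Subgroup.center E) = p

/-! Both conditions amount to $|G/Z(G)| = p^2$. The vertices of the graph correspond to the
nontrivial elements of $G/Z(G)$, so a graph on $(p+1)(p-1)$ vertices forces this order; an
extraspecial group of order $p^3$ has it, and isoclinism preserves it. Conversely, if $|G/Z(G)| =
p^2$, then $G$ has class two and the commutator map is bilinear and alternating. In suitable
coordinates it is the determinant on $\mathbb{F}_p^2$
(`exists_coordinates_of_card_quotient_center`). Hence all such groups are isoclinic, in particular
to the Heisenberg group over $\mathbb{F}_p$, and two vertices commute exactly when their vectors are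
proportional: each of the $p+1$ lines through the origin contributes a clique on its $p-1$ nonzero
vectors. -/

open scoped commutatorElement

/-- The homomorphism `ZMod n → A` sending `1` to `c`, for `c` with `c ^ n = 1`. -/
noncomputable def zmodPowersHom {A : Type*} [Group A] {n : ℕ} (c : A) (hc : c ^ n = 1) :
    Multiplicative (ZMod n) →* A :=
  AddMonoidHom.toMultiplicativeLeft (ZMod.lift n ⟨zmultiplesHom (Additive A) (Additive.ofMul c), by
    simpa [zmultiplesHom_apply] using congrArg Additive.ofMul hc⟩)

theorem zmodPowersHom_natCast {A : Type*} [Group A] {n : ℕ} (c : A) (hc : c ^ n = 1) (k : ℕ) :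
    zmodPowersHom c hc (Multiplicative.ofAdd (k : ZMod n)) = c ^ k := by
  have h := ZMod.lift_coe n (A := Additive A)
    ⟨zmultiplesHom (Additive A) (Additive.ofMul c), by
      simpa [zmultiplesHom_apply] using congrArg Additive.ofMul hc⟩ (k : ℤ)
  rw [Int.cast_natCast] at h
  refine (congrArg Additive.toMul h).trans ?_
  simp [zmultiplesHom_apply]

theorem zmodPowersHom_eq {A : Type*} [Group A] {n : ℕ} [NeZero n] (c : A) (hc : c ^ n = 1)
    (k : Multiplicative (ZMod n)) :
    zmodPowersHom c hc k = c ^ (Multiplicative.toAdd k).val := by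
  rw [← zmodPowersHom_natCast c hc, ZMod.natCast_zmod_val, ofAdd_toAdd]

/-! ### Commutators in groups with central quotient of order $p^2$ -/

section ClassTwo

variable {G : Type*} [Group G]

theorem commutatorElement_mul_left_of_mem_center {a b c : G} (h : ⁅b, c⁆ ∈ Subgroup.center G) :
    ⁅a * b, c⁆ = ⁅a, c⁆ * ⁅b, c⁆ := by
  rw [Subgroup.mem_center_iff] at h
  have e : ⁅a * b, c⁆ = a * ⁅b, c⁆ * c * a⁻¹ * c⁻¹ := by simp only [commutatorElement_def]; group
  rw [e, h a, mul_assoc, mul_assoc, mul_assoc, ← h]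
  simp only [commutatorElement_def]; group

theorem commutatorElement_mul_right_of_mem_center {a b c : G} (h : ⁅b, a⁆ ∈ Subgroup.center G)
    (h' : ⁅c, a⁆ ∈ Subgroup.center G) :
    ⁅a, b * c⁆ = ⁅a, b⁆ * ⁅a, c⁆ := by
  rw [← commutatorElement_inv, commutatorElement_mul_left_of_mem_center h', mul_inv_rev,
    commutatorElement_inv, commutatorElement_inv]
  rw [← commutatorElement_inv b a]
  exact (Subgroup.mem_center_iff.1 (inv_mem h) _)

theorem commutatorElement_pow_left (h : ∀ a b : G, ⁅a, b⁆ ∈ Subgroup.center G) (a b : G) (n : ℕ) :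
    ⁅a ^ n, b⁆ = ⁅a, b⁆ ^ n := by
  induction n with
  | zero => simp
  | succ n ih => rw [pow_succ, commutatorElement_mul_left_of_mem_center (h _ _), ih, pow_succ]

theorem commutatorElement_pow_right (h : ∀ a b : G, ⁅a, b⁆ ∈ Subgroup.center G) (a b : G) (n : ℕ) :
    ⁅a, b ^ n⁆ = ⁅a, b⁆ ^ n := by
  rw [← commutatorElement_inv, commutatorElement_pow_left h, ← inv_pow, commutatorElement_inv]

/-- In a group of class two, the commutator of `x ^ i * y ^ j` and `x ^ k * y ^ l`. -/
theorem commutatorElement_pow_mul_pow (h : ∀ a b : G, ⁅a, b⁆ ∈ Subgroup.center G) (x y : G)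
    (i j k l : ℕ) :
    ⁅x ^ i * y ^ j, x ^ k * y ^ l⁆ = ⁅x, y⁆ ^ (i * l) * (⁅x, y⁆ ^ (j * k))⁻¹ := by
  rw [commutatorElement_mul_left_of_mem_center (h _ _),
    commutatorElement_mul_right_of_mem_center (h _ _) (h _ _),
    commutatorElement_mul_right_of_mem_center (h _ _) (h _ _)]
  have e (u v w : G) (m n : ℕ) : ⁅u ^ m, v ^ n⁆ = ⁅u, v⁆ ^ (m * n) := by
    rw [commutatorElement_pow_left h, commutatorElement_pow_right h, ← pow_mul, mul_comm]
  simp only [e x y 1, e y x 1, e x x 1, e y y 1, commutatorElement_self, one_pow, one_mul, mul_one]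
  rw [← commutatorElement_inv x y, inv_pow]

-- An element of order $p^2$ would make $G/Z(G)$ cyclic, hence $G$ abelian.
variable (G) in
theorem pow_prime_eq_one_of_card_quotient_center {p : ℕ} (hp : p.Prime)
    (hG : ¬ ∀ x y : G, x * y = y * x)
    (hc : Nat.card (G ⧸ Subgroup.center G) = p ^ 2) (q : G ⧸ Subgroup.center G) : q ^ p = 1 := by
  have hd : orderOf q ∣ p ^ 2 := hc ▸ orderOf_dvd_natCard q
  obtain ⟨k, hk, e⟩ := (Nat.dvd_prime_pow hp).1 hd
  have hk2 : k ≠ 2 := by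
    rintro rfl
    have : Finite (G ⧸ Subgroup.center G) :=
      Nat.finite_of_card_ne_zero (by rw [hc]; exact pow_ne_zero _ hp.ne_zero)
    have : IsCyclic (G ⧸ Subgroup.center G) := isCyclic_of_orderOf_eq_card q (e.trans hc.symm)
    exact hG (MonoidHom.isMulCommutative_of_isCyclic_of_ker_le_center
      (QuotientGroup.mk' (Subgroup.center G)) (QuotientGroup.ker_mk' _).le).is_comm.comm
  rw [← orderOf_dvd_iff_pow_eq_one, e]
  calc p ^ k ∣ p ^ 1 := pow_dvd_pow _ (by omega)
    _ = p := pow_one p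

/-- Groups of order $p^2$ are abelian, so commutators vanish in $G/Z(G)$. -/
theorem commutatorElement_mem_center_of_card_quotient {p : ℕ} (hp : p.Prime)
    (hc : Nat.card (G ⧸ Subgroup.center G) = p ^ 2) (a b : G) : ⁅a, b⁆ ∈ Subgroup.center G := by
  have : Fact p.Prime := ⟨hp⟩
  have h := (IsPGroup.isMulCommutative_of_card_eq_prime_sq hc).is_comm.comm
    (a : G ⧸ Subgroup.center G) (b : G ⧸ Subgroup.center G)
  rw [← QuotientGroup.eq_one_iff]
  change ⁅(a : G ⧸ Subgroup.center G), (b : G ⧸ Subgroup.center G)⁆ = 1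
  rwa [commutatorElement_eq_one_iff_mul_comm]

/-- If `G / Z(G)` has order `p ^ 2`, then `G / Z(G)` and `G'` can be identified with `(ℤ / p) ^ 2`
and `ℤ / p` in such a way that the commutator map becomes the determinant. -/
theorem exists_coordinates_of_card_quotient_center {p : ℕ} (hp : p.Prime)
    (hG : ¬ ∀ x y : G, x * y = y * x)
    (hc : Nat.card (G ⧸ Subgroup.center G) = p ^ 2) :
    ∃ (θ : Multiplicative (ZMod p × ZMod p) ≃* G ⧸ Subgroup.center G)
      (η : Multiplicative (ZMod p) ≃* commutator G),
      ∀ u v : ZMod p × ZMod p,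
        commutatorMap G (θ (Multiplicative.ofAdd u)) (θ (Multiplicative.ofAdd v)) =
          η (Multiplicative.ofAdd (u.1 * v.2 - u.2 * v.1)) := by
  have : Fact p.Prime := ⟨hp⟩
  have hz := commutatorElement_mem_center_of_card_quotient hp hc
  have hpow := pow_prime_eq_one_of_card_quotient_center G hp hG hc
  have hcomm := (IsPGroup.isMulCommutative_of_card_eq_prime_sq hc).is_comm.comm
  push Not at hG
  obtain ⟨x, y, hxy⟩ := hG
  have hc1 : ⁅x, y⁆ ≠ 1 := by rwa [Ne, commutatorElement_eq_one_iff_mul_comm]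
  -- Since $x^p$ is central, $[x,y]^p = [x^p,y] = 1$.
  have hcp : ⁅x, y⁆ ^ p = 1 := by
    have hx := hpow (x : G ⧸ Subgroup.center G)
    rw [← QuotientGroup.mk_pow, QuotientGroup.eq_one_iff, Subgroup.mem_center_iff] at hx
    rw [← commutatorElement_pow_left hz, commutatorElement_eq_one_iff_mul_comm, hx]
  have hord : orderOf ⁅x, y⁆ = p := orderOf_eq_prime hcp hc1
  let θ₀ : Multiplicative (ZMod p × ZMod p) →* G ⧸ Subgroup.center G :=
    MonoidHom.mk' (fun u =>
        zmodPowersHom (x : G ⧸ Subgroup.center G) (hpow _) (Multiplicative.ofAdd u.toAdd.1) *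
        zmodPowersHom (y : G ⧸ Subgroup.center G) (hpow _) (Multiplicative.ofAdd u.toAdd.2)) (by
      intro u v
      simp only [toAdd_mul, Prod.fst_add, Prod.snd_add, ofAdd_add, map_mul]
      exact (show Commute _ _ from hcomm _ _).mul_mul_mul_comm _ _)
  have hθ (u : ZMod p × ZMod p) : θ₀ (Multiplicative.ofAdd u) =
      ((x ^ u.1.val * y ^ u.2.val : G) : G ⧸ Subgroup.center G) := by
    rw [MonoidHom.mk'_apply, zmodPowersHom_eq, zmodPowersHom_eq]; rfl
  let c : commutator G := ⟨⁅x, y⁆, Subgroup.commutator_mem_commutator (Subgroup.mem_top x) (Subgroup.mem_top y)⟩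
  have hcp' : c ^ p = 1 := Subtype.ext hcp
  let η₀ := zmodPowersHom c hcp'
  have hcompat (u v : ZMod p × ZMod p) :
        commutatorMap G (θ₀ (Multiplicative.ofAdd u)) (θ₀ (Multiplicative.ofAdd v)) =
          η₀ (Multiplicative.ofAdd (u.1 * v.2 - u.2 * v.1)) := by
    have e : u.1 * v.2 - u.2 * v.1 =
        ((u.1.val * v.2.val : ℕ) : ZMod p) - ((u.2.val * v.1.val : ℕ) : ZMod p) := by
      push_cast; simp only [ZMod.natCast_zmod_val]
    rw [hθ, hθ, e, ofAdd_sub, map_div, zmodPowersHom_natCast, zmodPowersHom_natCast, div_eq_mul_inv]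
    exact Subtype.ext (commutatorElement_pow_mul_pow hz x y _ _ _ _)
  have hη : Function.Injective η₀ := by
    rw [injective_iff_map_eq_one]
    intro k hk
    rw [zmodPowersHom_eq, Subtype.ext_iff] at hk
    have h := orderOf_dvd_of_pow_eq_one (show ⁅x, y⁆ ^ k.toAdd.val = 1 from hk)
    rw [hord, ← ZMod.natCast_eq_zero_iff, ZMod.natCast_zmod_val] at h
    exact h
  -- The determinant is nondegenerate: a kernel vector pairs to zero with everything, in particular
  -- with the two basis vectors.
  have hθi : Function.Injective θ₀ := by
    rw [injective_iff_map_eq_one]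
    intro u hu
    have key (v : ZMod p × ZMod p) : u.toAdd.1 * v.2 - u.toAdd.2 * v.1 = 0 := by
      have h := hcompat u.toAdd v
      rw [ofAdd_toAdd, hu, hθ] at h
      have h1 : commutatorMap G ((1 : G) : G ⧸ Subgroup.center G)
          ((x ^ v.1.val * y ^ v.2.val : G) : G ⧸ Subgroup.center G) = 1 :=
        Subtype.ext (by rw [commutatorMap_mk]; simp)
      exact hη (h.symm.trans (h1.trans (map_one η₀).symm))
    have h1 := key (0, 1)
    have h2 := key (1, 0)
    simp only [mul_one, mul_zero, sub_zero, zero_sub, neg_eq_zero] at h1 h2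
    exact Prod.ext h1 h2
  have hfin : Finite (G ⧸ Subgroup.center G) :=
    Nat.finite_of_card_ne_zero (by rw [hc]; exact pow_ne_zero _ hp.ne_zero)
  have hθb : Function.Bijective θ₀ := by
    refine (Nat.bijective_iff_injective_and_card _).2 ⟨hθi, ?_⟩
    rw [hc, Nat.card_congr Multiplicative.toAdd, Nat.card_prod, Nat.card_zmod, sq]
  have hηs : Function.Surjective η₀ := by
    -- As `θ₀` is onto, every commutator is a value of `η₀`, and commutators generate $G'$.
    have hle : commutator G ≤ (η₀.range.map (commutator G).subtype) := by
      refine (commutator_def G).le.trans (Subgroup.commutator_le.2 ?_)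
      intro a _ b _
      obtain ⟨u, hu⟩ := hθb.2 (a : G ⧸ Subgroup.center G)
      obtain ⟨v, hv⟩ := hθb.2 (b : G ⧸ Subgroup.center G)
      refine ⟨_, ⟨Multiplicative.ofAdd (u.toAdd.1 * v.toAdd.2 - u.toAdd.2 * v.toAdd.1), rfl⟩, ?_⟩
      rw [← hcompat, ofAdd_toAdd, ofAdd_toAdd, hu, hv]
      rfl
    intro d
    obtain ⟨d', ⟨k, hk⟩, hd⟩ := hle d.2
    exact ⟨k, hk.trans (Subtype.ext hd)⟩
  exact ⟨MulEquiv.ofBijective θ₀ hθb, MulEquiv.ofBijective η₀ ⟨hη, hηs⟩, hcompat⟩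

theorem isoclinic_of_card_quotient_center {H : Type*} [Group H] {p : ℕ} (hp : p.Prime)
    (hG : ¬ ∀ x y : G, x * y = y * x) (hH : ¬ ∀ x y : H, x * y = y * x)
    (hcG : Nat.card (G ⧸ Subgroup.center G) = p ^ 2)
    (hcH : Nat.card (H ⧸ Subgroup.center H) = p ^ 2) : Isoclinic G H := by
  obtain ⟨θ, η, h⟩ := exists_coordinates_of_card_quotient_center hp hG hcG
  obtain ⟨θ', η', h'⟩ := exists_coordinates_of_card_quotient_center hp hH hcH
  refine ⟨⟨θ.symm.trans θ', η.symm.trans η', fun x y => ?_⟩⟩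
  obtain ⟨u, hu⟩ := θ.surjective x
  obtain ⟨v, hv⟩ := θ.surjective y
  have e := h u.toAdd v.toAdd
  have e' := h' u.toAdd v.toAdd
  simp only [ofAdd_toAdd] at e e'
  simp only [← hu, ← hv, MulEquiv.trans_apply, MulEquiv.symm_apply_apply, e, e']

end ClassTwo

/-! ### The Heisenberg group as an extraspecial group -/

/-- The Heisenberg group of upper unitriangular `3 × 3` matrices over `R`, in coordinates. -/
@[ext]
structure HeisenbergGroup (R : Type*) where
  /-- The entry in position `(1, 2)`. -/
  x : R
  /-- The entry in position `(2, 3)`. -/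
  y : R
  /-- The entry in position `(1, 3)`. -/
  z : R

namespace HeisenbergGroup

/-- The coordinates identify the Heisenberg group with `R × R × R` as a set. -/
def equivProd (R : Type*) : HeisenbergGroup R ≃ R × R × R where
  toFun a := (a.x, a.y, a.z)
  invFun t := ⟨t.1, t.2.1, t.2.2⟩
  left_inv _ := rfl
  right_inv _ := rfl

theorem card_eq {R : Type*} : Nat.card (HeisenbergGroup R) = Nat.card R ^ 3 := by
  rw [Nat.card_congr (equivProd R), Nat.card_prod, Nat.card_prod]
  ring

variable {R : Type*} [CommRing R]

instance : Group (HeisenbergGroup R) where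
  mul a b := ⟨a.x + b.x, a.y + b.y, a.z + b.z + a.x * b.y⟩
  one := ⟨0, 0, 0⟩
  inv a := ⟨-a.x, -a.y, -a.z + a.x * a.y⟩
  mul_assoc a b c := by
    apply HeisenbergGroup.ext
    · exact add_assoc _ _ _
    · exact add_assoc _ _ _
    · change a.z + b.z + a.x * b.y + c.z + (a.x + b.x) * c.y =
        a.z + (b.z + c.z + b.x * c.y) + a.x * (b.y + c.y)
      ring
  one_mul a := by
    apply HeisenbergGroup.ext
    · exact zero_add _
    · exact zero_add _
    · change 0 + a.z + 0 * a.y = a.z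
      ring
  mul_one a := by
    apply HeisenbergGroup.ext
    · exact add_zero _
    · exact add_zero _
    · change a.z + 0 + a.x * 0 = a.z
      ring
  inv_mul_cancel a := by
    apply HeisenbergGroup.ext
    · exact neg_add_cancel _
    · exact neg_add_cancel _
    · change -a.z + a.x * a.y + a.z + -a.x * a.y = 0
      ring

@[simp] theorem mul_x (a b : HeisenbergGroup R) : (a * b).x = a.x + b.x := rfl
@[simp] theorem mul_y (a b : HeisenbergGroup R) : (a * b).y = a.y + b.y := rfl
@[simp] theorem mul_z (a b : HeisenbergGroup R) : (a * b).z = a.z + b.z + a.x * b.y := rfl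
@[simp] theorem inv_x (a : HeisenbergGroup R) : a⁻¹.x = -a.x := rfl
@[simp] theorem inv_y (a : HeisenbergGroup R) : a⁻¹.y = -a.y := rfl
@[simp] theorem inv_z (a : HeisenbergGroup R) : a⁻¹.z = -a.z + a.x * a.y := rfl

theorem mul_comm_iff (a b : HeisenbergGroup R) : a * b = b * a ↔ a.x * b.y = b.x * a.y := by
  constructor
  · intro h
    have := congrArg HeisenbergGroup.z h
    simp only [mul_z] at this
    linear_combination this
  · intro h
    ext <;> simp only [mul_x, mul_y, mul_z]
    · ring
    · ring
    · linear_combination h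

theorem mem_center_iff (a : HeisenbergGroup R) :
    a ∈ Subgroup.center (HeisenbergGroup R) ↔ a.x = 0 ∧ a.y = 0 := by
  simp only [Subgroup.mem_center_iff, mul_comm_iff]
  refine ⟨fun h => ⟨?_, ?_⟩, fun h g => by rw [h.1, h.2, mul_zero, zero_mul]⟩
  · simpa using (h ⟨0, 1, 0⟩).symm
  · simpa using h ⟨1, 0, 0⟩

theorem commutator_eq_center :
    commutator (HeisenbergGroup R) = Subgroup.center (HeisenbergGroup R) := by
  apply le_antisymm
  · rw [commutator_def, Subgroup.commutator_le]
    intro a _ b _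
    rw [mem_center_iff]
    simp [commutatorElement_def]
  · intro a ha
    rw [mem_center_iff] at ha
    have e : a = ⁅(⟨1, 0, 0⟩ : HeisenbergGroup R), ⟨0, a.z, 0⟩⁆ := by
      ext <;> simp [commutatorElement_def, ha.1, ha.2]
    rw [e]
    exact Subgroup.commutator_mem_commutator (Subgroup.mem_top _) (Subgroup.mem_top _)

theorem not_commutative [Nontrivial R] : ¬ ∀ a b : HeisenbergGroup R, a * b = b * a := by
  intro h
  have := (mul_comm_iff _ _).1 (h ⟨1, 0, 0⟩ ⟨0, 1, 0⟩)
  simp at this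

variable (R) in
/-- The center of the Heisenberg group is the copy of `R` given by the last coordinate. -/
def centerEquiv : Subgroup.center (HeisenbergGroup R) ≃ R where
  toFun a := a.1.z
  invFun r := ⟨⟨0, 0, r⟩, (mem_center_iff _).2 ⟨rfl, rfl⟩⟩
  left_inv a := by
    obtain ⟨hx, hy⟩ := (mem_center_iff _).1 a.2
    exact Subtype.ext (HeisenbergGroup.ext hx.symm hy.symm rfl)
  right_inv _ := rfl

/-- The first coordinate, as a homomorphism. -/
def xHom : HeisenbergGroup R →* Multiplicative R :=
  MonoidHom.mk' (fun a => Multiplicative.ofAdd a.x) fun _ _ => rfl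

/-- The second coordinate, as a homomorphism. -/
def yHom : HeisenbergGroup R →* Multiplicative R :=
  MonoidHom.mk' (fun a => Multiplicative.ofAdd a.y) fun _ _ => rfl

end HeisenbergGroup

/-- In a group of class at most two, the derived subgroup lies in every maximal subgroup. -/
theorem commutator_le_frattini_of_le_center {G : Type*} [Group G]
    (h : commutator G ≤ Subgroup.center G) : commutator G ≤ frattini G := by
  refine le_iInf₂ fun M hM => ?_
  by_contra hle
  -- A maximal `M` not containing $G'$ does not contain $Z(G)$ either, so $G = Z(G)M$ and every
  -- commutator of $G$ is already one of `M`.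
  have htop : Subgroup.center G ⊔ M = ⊤ := by
    refine hM.2 _ (lt_of_le_of_ne le_sup_right fun e => hle (h.trans ?_))
    exact le_sup_left.trans e.ge
  refine hle ?_
  rw [commutator_def, Subgroup.commutator_le]
  intro a _ b _
  obtain ⟨z, hz, m, hm, rfl⟩ := Subgroup.mem_sup_of_normal_left.1 (htop.ge (Subgroup.mem_top a))
  obtain ⟨w, hw, n, hn, rfl⟩ := Subgroup.mem_sup_of_normal_left.1 (htop.ge (Subgroup.mem_top b))
  have e : ⁅z * m, w * n⁆ = ⁅m, n⁆ := by
    have hc (c d : G) : ⁅c, d⁆ ∈ Subgroup.center G :=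
      h (Subgroup.commutator_mem_commutator (Subgroup.mem_top c) (Subgroup.mem_top d))
    rw [commutatorElement_mul_left_of_mem_center (hc _ _),
      commutatorElement_eq_one_iff_mul_comm.2 (Subgroup.mem_center_iff.1 hz _).symm,
      commutatorElement_mul_right_of_mem_center (hc _ _) (hc _ _),
      commutatorElement_eq_one_iff_mul_comm.2 (Subgroup.mem_center_iff.1 hw _), one_mul, one_mul]
  rw [e, commutatorElement_def]
  exact M.mul_mem (M.mul_mem (M.mul_mem hm hn) (M.inv_mem hm)) (M.inv_mem hn)

namespace HeisenbergGroup

variable {R : Type*} [CommRing R]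

theorem frattini_eq_center (hR : (Nat.card R).Prime) :
    Subgroup.center (HeisenbergGroup R) = frattini (HeisenbergGroup R) := by
  apply le_antisymm
  · rw [← commutator_eq_center]
    exact commutator_le_frattini_of_le_center commutator_eq_center.le
  · have : Fact (Nat.card R).Prime := ⟨hR⟩
    have : IsSimpleGroup (Multiplicative R) :=
      isSimpleGroup_of_prime_card (p := Nat.card R) (Nat.card_congr Multiplicative.toAdd)
    -- As `R` has prime order, the kernels of the two coordinate maps are maximal subgroups; they
    -- meet in the center.
    have hbot : IsCoatom (⊥ : Subgroup (Multiplicative R)) := isCoatom_bot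
    intro a ha
    have hx := (Subgroup.mem_iInf.1 (Subgroup.mem_iInf.1 ha _)
      (Subgroup.isCoatom_comap_of_surjective
        (φ := xHom (R := R)) (fun r => ⟨⟨r.toAdd, 0, 0⟩, rfl⟩) hbot))
    have hy := (Subgroup.mem_iInf.1 (Subgroup.mem_iInf.1 ha _)
      (Subgroup.isCoatom_comap_of_surjective
        (φ := yHom (R := R)) (fun r => ⟨⟨0, r.toAdd, 0⟩, rfl⟩) hbot))
    exact (mem_center_iff a).2 ⟨hx, hy⟩

theorem isExtraspecial (hR : (Nat.card R).Prime) :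
    IsExtraspecial (Nat.card R) (HeisenbergGroup R) where
  finite := Nat.finite_of_card_ne_zero (by rw [card_eq]; exact pow_ne_zero _ hR.ne_zero)
  isPGroup := IsPGroup.of_card card_eq
  nonabelian := by
    have : Finite R := Nat.finite_of_card_ne_zero hR.ne_zero
    have : Nontrivial R := Finite.one_lt_card_iff_nontrivial.1 hR.one_lt
    exact not_commutative
  commutator_eq_center := commutator_eq_center
  center_eq_frattini := frattini_eq_center hR
  card_center := Nat.card_congr (centerEquiv R)

end HeisenbergGroup

theorem IsExtraspecial.card_quotient_center {p : ℕ} (hp : p.Prime) {E : Type*} [Group E]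
    (h : IsExtraspecial p E) (hc : Nat.card E = p ^ 3) :
    Nat.card (E ⧸ Subgroup.center E) = p ^ 2 := by
  have e := Subgroup.card_eq_card_quotient_mul_card_subgroup (Subgroup.center E)
  rw [hc, h.card_center, pow_succ] at e
  exact (Nat.eq_of_mul_eq_mul_right hp.pos e).symm

/-! ### The graph and the lines of the plane -/

section Graph

/-- Nonzero vectors of the plane, parametrized by a slope and a scalar. -/
def slopeVector {F : Type*} [Field F] : Option F × Fˣ → F × F
  | (none, u) => (0, u)
  | (some m, u) => (u, m * u)

theorem slopeVector_ne_zero {F : Type*} [Field F] (a : Option F × Fˣ) : slopeVector a ≠ 0 := by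
  obtain ⟨_ | m, u⟩ := a <;> simp [slopeVector, Prod.ext_iff]

theorem slopeVector_injective {F : Type*} [Field F] :
    Function.Injective (slopeVector : Option F × Fˣ → F × F) := by
  rintro ⟨_ | m, u⟩ ⟨_ | n, v⟩ h <;> obtain ⟨h1, h2⟩ := Prod.ext_iff.1 h
  · rw [Units.ext (show (u : F) = v from h2)]
  · exact absurd h1.symm v.ne_zero
  · exact absurd h1 u.ne_zero
  · obtain rfl := Units.ext (show (u : F) = v from h1)
    rw [mul_right_cancel₀ u.ne_zero (show m * (u : F) = n * u from h2)]

theorem exists_slopeVector_eq {F : Type*} [Field F] {w : F × F} (hw : w ≠ 0) :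
    ∃ a, slopeVector a = w := by
  obtain ⟨r, s⟩ := w
  by_cases hr : r = 0
  · subst hr
    have hs : s ≠ 0 := fun h => hw (by rw [h]; rfl)
    exact ⟨(none, Units.mk0 s hs), rfl⟩
  · exact ⟨(some (s / r), Units.mk0 r hr), by simp [slopeVector, hr]⟩

/-- Nonzero vectors are dependent exactly when they span the same line; `none` is the slope of the
vertical one. -/
theorem slopeVector_det_eq_zero_iff {F : Type*} [Field F] (a b : Option F × Fˣ) :
    (slopeVector a).1 * (slopeVector b).2 - (slopeVector a).2 * (slopeVector b).1 = 0 ↔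
      a.1 = b.1 := by
  obtain ⟨_ | m, u⟩ := a <;> obtain ⟨_ | n, v⟩ := b <;> simp only [slopeVector]
  · simp
  · simp
  · simp
  · have e : (u : F) * (n * v) - m * u * v = (n - m) * (u * v) := by ring
    rw [e, mul_eq_zero, or_iff_left (mul_ne_zero u.ne_zero v.ne_zero), sub_eq_zero,
      Option.some_inj, eq_comm]

variable {G : Type*} [Group G] {T : Set G}

/-- The vertices of the graph on a transversal of the center are the nontrivial elements of the
central quotient. -/
theorem bijective_mk_diff_center (hT : Subgroup.IsComplement T (Subgroup.center G : Set G)) :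
    Function.Bijective (fun t : (T \ (Subgroup.center G : Set G) : Set G) =>
      (⟨((t : G) : G ⧸ Subgroup.center G), fun h => t.2.2 ((QuotientGroup.eq_one_iff _).1 h)⟩ :
        {q : G ⧸ Subgroup.center G // q ≠ 1})) := by
  have hb := Subgroup.isComplement_subgroup_right_iff_bijective.1 hT
  constructor
  · intro s t h
    have := @hb.1 ⟨s, s.2.1⟩ ⟨t, t.2.1⟩ (congrArg Subtype.val h)
    exact Subtype.ext (congrArg (fun t : T => (t : G)) this)
  · rintro ⟨q, hq⟩
    obtain ⟨t, ht⟩ := hb.2 q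
    refine ⟨⟨t, t.2, fun h => hq ?_⟩, Subtype.ext ht⟩
    rw [← ht]
    exact (QuotientGroup.eq_one_iff _).2 h

/-- Counting vertices is enough: $(p+1)(p-1) + 1 = p^2$, the extra element being the identity coset.
-/
theorem card_quotient_center_of_iso [Finite G] {p : ℕ} (hp : p.Prime)
    (hT : Subgroup.IsComplement T (Subgroup.center G : Set G))
    (f : transversalGraph T ≃g
      disjointCopies (p + 1) (SimpleGraph.completeGraph (Fin (p - 1)))) :
    Nat.card (G ⧸ Subgroup.center G) = p ^ 2 := by
  classical
  have h1 := Nat.card_congr f.toEquiv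
  rw [Nat.card_congr (Equiv.ofBijective _ (bijective_mk_diff_center hT)), Nat.card_prod,
    Nat.card_fin, Nat.card_fin] at h1
  have h2 := Nat.card_congr (Equiv.optionSubtypeNe (1 : G ⧸ Subgroup.center G))
  rw [Finite.card_option, h1] at h2
  rw [← h2]
  obtain ⟨k, rfl⟩ := Nat.exists_eq_add_of_le' hp.one_le
  rw [Nat.add_sub_cancel]
  ring

theorem nonempty_iso_of_card_quotient_center {p : ℕ} (hp : p.Prime)
    (hG : ¬ ∀ x y : G, x * y = y * x)
    (hT : Subgroup.IsComplement T (Subgroup.center G : Set G))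
    (hc : Nat.card (G ⧸ Subgroup.center G) = p ^ 2) :
    Nonempty (transversalGraph T ≃g
      disjointCopies (p + 1) (SimpleGraph.completeGraph (Fin (p - 1)))) := by
  have : Fact p.Prime := ⟨hp⟩
  obtain ⟨θ, η, h⟩ := exists_coordinates_of_card_quotient_center hp hG hc
  let e₁ : Fin (p + 1) ≃ Option (ZMod p) := (Finite.equivFinOfCardEq (by simp)).symm
  let e₂ : Fin (p - 1) ≃ (ZMod p)ˣ := (Finite.equivFinOfCardEq (by
    rw [Nat.card_eq_fintype_card, ZMod.card_units])).symm
  let e := e₁.prodCongr e₂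
  let V : Option (ZMod p) × (ZMod p)ˣ → {q : G ⧸ Subgroup.center G // q ≠ 1} :=
    fun a => ⟨θ (Multiplicative.ofAdd (slopeVector a)), fun h1 =>
      slopeVector_ne_zero a (θ.map_eq_one_iff.1 h1)⟩
  have hV : Function.Bijective V := by
    constructor
    · intro a b hab
      exact slopeVector_injective (θ.injective (congrArg Subtype.val hab))
    · rintro ⟨q, hq⟩
      obtain ⟨w, rfl⟩ := θ.surjective q
      have hw : w.toAdd ≠ 0 := fun h0 => hq (θ.map_eq_one_iff.2 h0)
      obtain ⟨a, ha⟩ := exists_slopeVector_eq hw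
      exact ⟨a, Subtype.ext (congrArg (fun w => θ (Multiplicative.ofAdd w)) ha)⟩
  let τ := Equiv.ofBijective _ (bijective_mk_diff_center hT)
  let f : Fin (p + 1) × Fin (p - 1) ≃ (T \ (Subgroup.center G : Set G) : Set G) :=
    (e.trans (Equiv.ofBijective V hV)).trans τ.symm
  have hf (a : Fin (p + 1) × Fin (p - 1)) : ((f a : G) : G ⧸ Subgroup.center G) =
      θ (Multiplicative.ofAdd (slopeVector (e a))) :=
    congrArg Subtype.val (τ.apply_symm_apply (V (e a)))
  refine ⟨RelIso.symm ⟨f, @fun a b => ?_⟩⟩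
  -- The copy index is the slope, so commuting means a zero determinant, that is, the same copy.
  have hcomm : (f a : G) * f b = f b * f a ↔ a.1 = b.1 := by
    rw [← commutatorElement_eq_one_iff_mul_comm]
    have hm := h (slopeVector (e a)) (slopeVector (e b))
    rw [← hf, ← hf] at hm
    have h1 : ⁅(f a : G), (f b : G)⁆ = 1 ↔
        commutatorMap G ((f a : G) : G ⧸ Subgroup.center G) ((f b : G) : G ⧸ Subgroup.center G)
          = 1 := by
      rw [Subtype.ext_iff]; rfl
    rw [h1, hm, η.map_eq_one_iff]
    exact (slopeVector_det_eq_zero_iff (e a) (e b)).trans e₁.injective.eq_iff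
  change (f a ≠ f b ∧ (f a : G) * f b = f b * f a) ↔ (a.1 = b.1 ∧ a.2 ≠ b.2)
  rw [hcomm, f.injective.ne_iff, Ne, Prod.ext_iff]
  tauto

end Graph

theorem proposition3p11 {G : Type u} [Group G] [Finite G]
    (hG : ¬ ∀ x y : G, x * y = y * x) {p : ℕ} (hp : p.Prime)
    (T : Set G) (hT : Subgroup.IsComplement T (Subgroup.center G : Set G)) :
    Nonempty (transversalGraph T ≃g disjointCopies (p + 1) (SimpleGraph.completeGraph (Fin (p - 1)))) ↔
      ∃ (E : Type u) (_ : Group E),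
        IsExtraspecial p E ∧ Nat.card E = p ^ 3 ∧ Isoclinic G E := by
  constructor
  · rintro ⟨f⟩
    have hc := card_quotient_center_of_iso hp hT f
    -- The lift puts the Heisenberg group in the universe of `G`.
    have hR : Nat.card (ULift.{u} (ZMod p)) = p := by
      rw [Nat.card_congr Equiv.ulift, Nat.card_zmod]
    have hE := HeisenbergGroup.isExtraspecial (R := ULift.{u} (ZMod p)) (hR.symm ▸ hp)
    have hcE := HeisenbergGroup.card_eq (R := ULift.{u} (ZMod p))
    rw [hR] at hE hcE
    exact ⟨HeisenbergGroup (ULift.{u} (ZMod p)), inferInstance, hE, hcE,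
      isoclinic_of_card_quotient_center hp hG hE.nonabelian hc (hE.card_quotient_center hp hcE)⟩
  · rintro ⟨E, _, hE, hcE, ⟨i⟩⟩
    refine nonempty_iso_of_card_quotient_center hp hG hT ?_
    rw [Nat.card_congr i.φ.toEquiv, hE.card_quotient_center hp hcE]
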